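/- Let $d\in\mathbb N$, $\lambda>0$, $\delta>0$, and let $f:\mathbb R^d\to\mathbb R$ be continuous, have at least one minimizer, and satisfy $\int_{\mathbb R^d}\exp(-f(y)/\delta)\,dy<+\infty$. For $x\in\mathbb R^d$ define the zeroth-order proximal operator (ZOPO) \[ \operatorname{zprox}^{\delta}_{\lambda,f}(x)=\frac{\mathbb E_{y\sim\mathcal N(x,\lambda\delta I)}\left[y\exp(-f(y)/\delta)\right]}{\mathbb E_{y\sim\mathcal N(x,\lambda\delta I)}\left[\exp(-f(y)/\delta)\right]} \] and the soft Moreau envelope \[ f^{\lambda,\delta}(x)=-\delta\log\mathbb E_{y\sim\mathcal N(x,\lambda\delta I)}\left[\exp(-f(y)/\delta)\right]. \] These are well defined: for every $x$ both integrands are integrable and $\mathbb E_{y\sim\mathcal N(x,\lambda\delta I)}[\exp(-f(y)/\delta)]>0$. Moreover, $\operatorname{zprox}^{\delta}_{\lambda,f}:\mathbb R^d\to\mathbb R^d$ is $C^\infty$ and bijective, and its inverse is $C^\infty$, so that it is a smooth diffeomorphism of $\mathbb R^d$. With $H_{\lambda,\delta}:\mathbb R^d\to\mathbb R$ defined by \[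 H_{\lambda,\delta}(x)=-\frac{1}{2\lambda\delta}\left\|(\operatorname{zprox}^{\delta}_{\lambda,f})^{-1}(x)-x\right\|^2+\frac1\delta f^{\lambda,\delta}\left((\operatorname{zprox}^{\delta}_{\lambda,f})^{-1}(x)\right), \] one has \[ \operatorname{zprox}^{\delta}_{\lambda,f}=\operatorname{prox}_{\lambda\delta H_{\lambda,\delta}}, \] that is, for every $x\in\mathbb R^d$ the function $y\mapsto H_{\lambda,\delta}(y)+\frac{1}{2\lambda\delta}\|x-y\|^2$ has exactly one global minimizer, namely $\operatorname{zprox}^{\delta}_{\lambda,f}(x)$. In particular, every sequence $(x^k)_{k\in\mathbb N}$ generated by ZOPPA, i.e. $x^{k+1}=\operatorname{zprox}^{\delta}_{\lambda,f}(x^k)$ for all $k\ge 0$ with arbitrary $x^0\in\mathbb R^d$, is an exact proximal point iteration: $x^{k+1}=\operatorname{prox}_{\lambda\delta H_{\lambda,\delta}}(x^k)$ for all $k\ge0$. -/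

import Mathlib

open MeasureTheory ProbabilityTheory
open scoped ContDiff

noncomputable section

/-- The standing assumption on the objective at temperature `δ`: `f` is continuous, has a
minimizer, and `exp (-f / δ)` is integrable with respect to Lebesgue measure. -/
structure StandingAssumption {d : ℕ} (δ : ℝ) (f : EuclideanSpace ℝ (Fin d) → ℝ) : Prop where
  continuous : Continuous f
  exists_minimizer : ∃ x₀, ∀ x, f x₀ ≤ f x
  integrable : Integrable (fun y => Real.exp (-f y / δ)) volume

/-- The Gaussian proposal `𝒩(x, lam δ I)`. -/
def proposal {d : ℕ} (lam δ : ℝ) (x : EuclideanSpace ℝ (Fin d)) :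
    Measure (EuclideanSpace ℝ (Fin d)) :=
  multivariateGaussian x ((lam * δ) • (1 : Matrix (Fin d) (Fin d) ℝ))

/-- The zeroth-order proximal operator: the quotient of `𝔼[exp (-f(y)/δ) y]` by
`𝔼[exp (-f(y)/δ)]`, where `y ∼ 𝒩(x, lam δ I)`. -/
def zprox {d : ℕ} (lam δ : ℝ) (f : EuclideanSpace ℝ (Fin d) → ℝ)
    (x : EuclideanSpace ℝ (Fin d)) : EuclideanSpace ℝ (Fin d) :=
  (∫ y, Real.exp (-f y / δ) ∂(proposal lam δ x))⁻¹ •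
    ∫ y, Real.exp (-f y / δ) • y ∂(proposal lam δ x)

/-- The inverse map of `zprox` (meaningful because `zprox` is bijective, which is part of the
theorem). -/
def zproxInv {d : ℕ} (lam δ : ℝ) (f : EuclideanSpace ℝ (Fin d) → ℝ) :
    EuclideanSpace ℝ (Fin d) → EuclideanSpace ℝ (Fin d) :=
  Function.invFun (zprox lam δ f)

/-- The soft Moreau envelope `-δ log 𝔼[exp (-f(y)/δ)]`, where `y ∼ 𝒩(x, lam δ I)`. -/
def softMoreauEnvelope {d : ℕ} (lam δ : ℝ) (f : EuclideanSpace ℝ (Fin d) → ℝ)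
    (x : EuclideanSpace ℝ (Fin d)) : ℝ :=
  -δ * Real.log (∫ y, Real.exp (-f y / δ) ∂(proposal lam δ x))

/-- The function `H` whose proximal operator is `zprox`. -/
def proxPotential {d : ℕ} (lam δ : ℝ) (f : EuclideanSpace ℝ (Fin d) → ℝ)
    (x : EuclideanSpace ℝ (Fin d)) : ℝ :=
  -(1 / (2 * lam * δ)) * ‖zproxInv lam δ f x - x‖ ^ 2
    + (1 / δ) * softMoreauEnvelope lam δ f (zproxInv lam δ f x)

/-- `prox_{γ H}(x)` as a set: all global minimizers `y` of `H y + ‖x - y‖² / (2 γ)`. -/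
def proxSet {d : ℕ} (γ : ℝ) (H : EuclideanSpace ℝ (Fin d) → ℝ)
    (x : EuclideanSpace ℝ (Fin d)) : Set (EuclideanSpace ℝ (Fin d)) :=
  {y | ∀ z, H y + 1 / (2 * γ) * ‖x - y‖ ^ 2 ≤ H z + 1 / (2 * γ) * ‖x - z‖ ^ 2}

/-- `T = prox_{γ H}` as maps: for every `x` the minimization problem defining `prox_{γ H}(x)`
has exactly one solution, namely `T x`. -/
def IsProxOf {d : ℕ} (T : EuclideanSpace ℝ (Fin d) → EuclideanSpace ℝ (Fin d))
    (γ : ℝ) (H : EuclideanSpace ℝ (Fin d) → ℝ) : Prop :=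
  ∀ x, proxSet γ H x = {T x}

/-- A sequence generated by ZOPPA (from the initial point `x 0`). -/
def IsZOPPASequence {d : ℕ} (lam δ : ℝ) (f : EuclideanSpace ℝ (Fin d) → ℝ)
    (x : ℕ → EuclideanSpace ℝ (Fin d)) : Prop :=
  ∀ k, x (k + 1) = zprox lam δ f (x k)

/-- An (exact) proximal point iteration for `H` with stepsize `γ`: each `x (k + 1)` is the
unique proximal point `prox_{γ H}(x k)`. -/
def IsProximalPointIteration {d : ℕ} (γ : ℝ) (H : EuclideanSpace ℝ (Fin d) → ℝ)
    (x : ℕ → EuclideanSpace ℝ (Fin d)) : Prop :=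
  ∀ k, proxSet γ H (x k) = {x (k + 1)}

end

/-!
Write `τ = lam δ`. The proposal `𝒩(x, τ I)` has density proportional to `exp (-‖y - x‖² / (2 τ))`
(`proposal_eq_withDensity`). Expanding the square, an expectation under it of a function weighted by
`exp (-f/δ)` is, up to a positive factor depending on `x` only, an integral against the fixed
measure `μ` with density `exp (-‖y‖² / (2 τ) - f(y)/δ)`, tilted by `exp ⟪x/τ, y⟫`. Hence
`zprox x = ∇Λ(x/τ)`, where `Λ = log ∫ exp ⟪u, y⟫ ∂μ` is the log-Laplace transform of `μ`
(`zprox_eq_tiltedMean`), and the soft Moreau envelope is an explicit quadratic minus `δ Λ(x/τ)`.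

The measure `μ` has finite exponential moments of every order and charges every nonempty open set.
For any such measure, `∇Λ` is a smooth diffeomorphism:

* it is smooth by differentiation under the integral sign (`HasExpMoments.contDiff`);
* it is injective because `Λ` lies strictly above its tangent planes (`log_laplace_add_inner_lt`),
  which is `exp t ≥ 1 + t` with its equality case, integrated against the tilted measure;
* it attains every `p`, because `u ↦ ∫ exp ⟪u, y - p⟫ ∂μ` is coercive and its critical points solve
  `∇Λ(u) = p` (`tiltedMean_surjective`);
* its derivative is the covariance of the tilted measure, which is positive definite
  (`fderiv_tiltedMean_injective`), so the inverse is smooth by the inverse function theorem.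

For the proximal representation, evaluate the prox objective at `y = zprox u`. The quadratic terms
in `u` and `y` cancel, and what remains is a function of `x` minus the value at `x/τ` of the tangent
plane of `Λ` at `u/τ` (`proxPotential_zprox_add`). By the strict tangent plane inequality it is
minimal exactly at `u = x`.
-/

/-! ### Preliminaries -/

section Preliminaries

open scoped RealInnerProductSpace

theorem exists_inner_eq {E : Type*} [NormedAddCommGroup E] [InnerProductSpace ℝ E] {w : E}
    (hw : w ≠ 0) (m : ℝ) : ∃ y : E, ⟪w, y⟫ = m :=
  ⟨(m / ‖w‖ ^ 2) • w, by
    have := norm_ne_zero_iff.2 hw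
    rw [inner_smul_right, real_inner_self_eq_norm_sq]
    field_simp⟩

/-- A right inverse of an injective smooth map with everywhere injective derivative is smooth. -/
theorem ContDiff.of_rightInverse {E : Type*} [NormedAddCommGroup E]
    [NormedSpace ℝ E] [FiniteDimensional ℝ E] {T g : E → E}
    (hT : ContDiff ℝ ∞ T) (hinj : Function.Injective T)
    (hd : ∀ u, Function.Injective (fderiv ℝ T u)) (hg : Function.RightInverse g T) :
    ContDiff ℝ ∞ g := by
  refine contDiff_iff_contDiffAt.2 fun y => ?_
  let e : E ≃L[ℝ] E :=
    (LinearEquiv.ofInjectiveEndo (fderiv ℝ T (g y) : E →ₗ[ℝ] E) (hd _)).toContinuousLinearEquiv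
  have he : HasFDerivAt T (e : E →L[ℝ] E) (g y) := by
    have := (hT.differentiable (by simp) (g y)).hasFDerivAt
    refine this.congr_fderiv ?_
    ext v
    rfl
  have hTa : ContDiffAt ℝ ∞ T (g y) := hT.contDiffAt
  -- the local inverse at `g y` is a right inverse near `y`, hence equals `g` there by injectivity
  have hloc := hTa.to_localInverse he (by simp)
  rw [hg y] at hloc
  refine hloc.congr_of_eventuallyEq ?_
  have hr := (hTa.hasStrictFDerivAt' he (by simp)).eventually_right_inverse
  rw [hg y] at hr
  filter_upwards [hr] with z hz
  exact hinj ((hg z).trans hz.symm)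

end Preliminaries

/-! ### Exponential moments and differentiation of Laplace integrals -/

noncomputable section Laplace

open scoped RealInnerProductSpace

/-- `g` is almost everywhere strongly measurable and `‖g‖` has finite exponential moments of every
order against `μ`. The class is closed under the tensor multiplication `y ⊗ g y` that
differentiation of `u ↦ ∫ exp ⟪u, y⟫ • g y ∂μ` produces. -/
structure HasExpMoments {E F : Type*} [NormedAddCommGroup E] [MeasurableSpace E]
    [NormedAddCommGroup F] (μ : Measure E) (g : E → F) : Prop where
  aestronglyMeasurable : AEStronglyMeasurable g μ
  integrable_exp_mul : ∀ A : ℝ, Integrable (fun y => Real.exp (A * ‖y‖) * ‖g y‖) μ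

theorem exp_mul_norm_mul_norm_le {E : Type*} [SeminormedAddCommGroup E] (A : ℝ)
    (y : E) :
    Real.exp (A * ‖y‖) * ‖y‖ ≤ Real.exp ((A + 1) * ‖y‖) := by
  rw [add_mul, Real.exp_add, one_mul]
  gcongr
  linarith [Real.add_one_le_exp ‖y‖]

theorem hasExpMoments_one {E : Type*} [NormedAddCommGroup E] [MeasurableSpace E] {μ : Measure E}
    (hμ : ∀ A : ℝ, Integrable (fun y => Real.exp (A * ‖y‖)) μ) :
    HasExpMoments μ (fun _ => (1 : ℝ)) :=
  ⟨aestronglyMeasurable_const, fun A => by simpa using hμ A⟩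

variable {E F : Type} [NormedAddCommGroup E] [InnerProductSpace ℝ E] [MeasurableSpace E]
  [NormedAddCommGroup F] [NormedSpace ℝ F] {μ : Measure E}

variable [BorelSpace E]

theorem HasExpMoments.integrable {g : E → F} (hg : HasExpMoments μ g) (u : E) :
    Integrable (fun y => Real.exp ⟪u, y⟫ • g y) μ := by
  refine (hg.integrable_exp_mul ‖u‖).mono' ?_ (.of_forall fun y => ?_)
  · exact (Continuous.aestronglyMeasurable (by fun_prop)).smul hg.aestronglyMeasurable
  · rw [norm_smul, Real.norm_eq_abs, Real.abs_exp]
    gcongr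
    exact real_inner_le_norm u y

theorem integrable_exp_inner (hμ : ∀ A : ℝ, Integrable (fun y => Real.exp (A * ‖y‖)) μ) (u : E) :
    Integrable (fun y => Real.exp ⟪u, y⟫) μ := by
  simpa using (hasExpMoments_one hμ).integrable u

/-- The Laplace transform `u ↦ ∫ exp ⟪u, y⟫ ∂μ`. -/
def laplace (μ : Measure E) (u : E) : ℝ := ∫ y, Real.exp ⟪u, y⟫ ∂μ

theorem laplace_pos (hμ : ∀ A : ℝ, Integrable (fun y => Real.exp (A * ‖y‖)) μ)
    [μ.IsOpenPosMeasure] (u : E) : 0 < laplace μ u :=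
  integral_pos_of_integrable_nonneg_nonzero (x := 0) (by fun_prop) (integrable_exp_inner hμ u)
    (fun _ => (Real.exp_pos _).le) (Real.exp_pos _).ne'

variable [FiniteDimensional ℝ E]

/-- Multiplying by the linear form `⟪y, ·⟫` costs one factor `‖y‖`, absorbed by `exp ‖y‖`. -/
theorem HasExpMoments.smulRight {g : E → F} (hg : HasExpMoments μ g) :
    HasExpMoments μ (fun y => (innerSL ℝ y).smulRight (g y)) := by
  have hm : AEStronglyMeasurable (fun y => (innerSL ℝ y).smulRight (g y)) μ :=
    (ContinuousLinearMap.smulRightL ℝ E F).aestronglyMeasurable_comp₂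
      (innerSL ℝ).continuous.aestronglyMeasurable hg.aestronglyMeasurable
  refine ⟨hm, fun A => (hg.integrable_exp_mul (A + 1)).mono' ?_ (.of_forall fun y => ?_)⟩
  · exact (Continuous.aestronglyMeasurable (by fun_prop)).mul hm.norm
  · rw [ContinuousLinearMap.norm_smulRight_apply, innerSL_apply_norm, Real.norm_of_nonneg
      (by positivity), ← mul_assoc]
    exact mul_le_mul_of_nonneg_right (exp_mul_norm_mul_norm_le A y) (norm_nonneg _)

theorem hasExpMoments_id (hμ : ∀ A : ℝ, Integrable (fun y => Real.exp (A * ‖y‖)) μ) :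
    HasExpMoments μ (fun y => y) := by
  refine ⟨continuous_id.aestronglyMeasurable, fun A => (hμ (A + 1)).mono' ?_
    (.of_forall fun y => ?_)⟩
  · exact Continuous.aestronglyMeasurable (by fun_prop)
  · rw [Real.norm_of_nonneg (by positivity)]
    exact exp_mul_norm_mul_norm_le A y

theorem HasExpMoments.hasFDerivAt {g : E → F} (hg : HasExpMoments μ g) (u : E) :
    HasFDerivAt (fun u => ∫ y, Real.exp ⟪u, y⟫ • g y ∂μ)
      (∫ y, Real.exp ⟪u, y⟫ • (innerSL ℝ y).smulRight (g y) ∂μ) u := by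
  have hm := fun u => (hg.integrable u).aestronglyMeasurable
  refine hasFDerivAt_integral_of_dominated_of_fderiv_le
    (F' := fun u y => Real.exp ⟪u, y⟫ • (innerSL ℝ y).smulRight (g y))
    (Metric.ball_mem_nhds u one_pos) (.of_forall hm) (hg.integrable u)
    (hg.smulRight.integrable u).aestronglyMeasurable (.of_forall fun y v hv => ?_)
    (hg.smulRight.integrable_exp_mul (‖u‖ + 1)) (.of_forall fun y v _ => ?_)
  · rw [norm_smul, Real.norm_eq_abs, Real.abs_exp]
    gcongr
    refine (real_inner_le_norm v y).trans ?_
    gcongr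
    have := norm_sub_norm_le v u
    rw [Metric.mem_ball, dist_eq_norm] at hv
    linarith
  · have h1 : HasFDerivAt (fun v : E => ⟪v, y⟫) (innerSL ℝ y) v := by
      simpa only [← innerSL_apply_apply ℝ y, real_inner_comm] using
        (innerSL ℝ y).hasFDerivAt (x := v)
    convert h1.exp.smul_const (g y) using 1
    ext w
    simp [mul_smul]

/-- Each differentiation replaces `g` by `y ↦ ⟪y, ·⟫ ⊗ g y`, which again has exponential moments,
so the induction runs over all targets `F` at once. -/
theorem HasExpMoments.contDiff {g : E → F} (hg : HasExpMoments μ g) :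
    ContDiff ℝ ∞ (fun u => ∫ y, Real.exp ⟪u, y⟫ • g y ∂μ) := by
  refine contDiff_infty.2 fun n => ?_
  induction n generalizing F with
  | zero =>
    exact contDiff_zero.2
      (continuous_iff_continuousAt.2 fun u => (hg.hasFDerivAt u).continuousAt)
  | succ n ih =>
    push_cast
    exact contDiff_succ_iff_hasFDerivAt.2 ⟨_, ih hg.smulRight, hg.hasFDerivAt⟩

/-! ### The gradient of a log-Laplace transform -/

/-- The unnormalized first moment of the exponentially tilted measure; it is the gradient of
`laplace μ` at `u`. -/
def tiltedMoment (μ : Measure E) (u : E) : E := ∫ y, Real.exp ⟪u, y⟫ • y ∂μ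

/-- The mean of the probability measure proportional to `exp ⟪u, y⟫ ∂μ`; it is the gradient of
`log ∘ laplace μ` at `u`. -/
def tiltedMean (μ : Measure E) (u : E) : E :=
  (laplace μ u)⁻¹ • tiltedMoment μ u


theorem integrable_exp_inner_mul_inner
    (hμ : ∀ A : ℝ, Integrable (fun y => Real.exp (A * ‖y‖)) μ) (u v : E) :
    Integrable (fun y => Real.exp ⟪u, y⟫ * ⟪v, y⟫) μ := by
  simpa [inner_smul_right] using ((hasExpMoments_id hμ).integrable u).const_inner (𝕜 := ℝ) v

theorem integral_exp_inner_mul_inner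
    (hμ : ∀ A : ℝ, Integrable (fun y => Real.exp (A * ‖y‖)) μ) (u v : E) :
    ∫ y, Real.exp ⟪u, y⟫ * ⟪v, y⟫ ∂μ = ⟪v, tiltedMoment μ u⟫ := by
  rw [tiltedMoment, ← integral_inner ((hasExpMoments_id hμ).integrable u)]
  simp [inner_smul_right]

theorem hasFDerivAt_laplace (hμ : ∀ A : ℝ, Integrable (fun y => Real.exp (A * ‖y‖)) μ) (u : E) :
    HasFDerivAt (laplace μ) (innerSL ℝ (tiltedMoment μ u)) u := by
  have h := (hasExpMoments_one hμ).hasFDerivAt u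
  simp only [smul_eq_mul, mul_one] at h
  refine h.congr_fderiv ?_
  ext v
  rw [ContinuousLinearMap.integral_apply ((hasExpMoments_one hμ).smulRight.integrable u),
    innerSL_apply_apply, real_inner_comm, ← integral_exp_inner_mul_inner hμ]
  simp [real_inner_comm]

theorem contDiff_laplace (hμ : ∀ A : ℝ, Integrable (fun y => Real.exp (A * ‖y‖)) μ) :
    ContDiff ℝ ∞ (laplace μ) := by
  have h := (hasExpMoments_one hμ).contDiff
  simp only [smul_eq_mul, mul_one] at h
  exact h

theorem contDiff_tiltedMoment (hμ : ∀ A : ℝ, Integrable (fun y => Real.exp (A * ‖y‖)) μ) :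
    ContDiff ℝ ∞ (tiltedMoment μ) :=
  (hasExpMoments_id hμ).contDiff

theorem contDiff_tiltedMean (hμ : ∀ A : ℝ, Integrable (fun y => Real.exp (A * ‖y‖)) μ)
    [μ.IsOpenPosMeasure] : ContDiff ℝ ∞ (tiltedMean μ) :=
  ((contDiff_laplace hμ).inv fun u => (laplace_pos hμ u).ne').smul (contDiff_tiltedMoment hμ)

theorem laplace_smul_tiltedMean (hμ : ∀ A : ℝ, Integrable (fun y => Real.exp (A * ‖y‖)) μ)
    [μ.IsOpenPosMeasure] (u : E) : laplace μ u • tiltedMean μ u = tiltedMoment μ u :=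
  smul_inv_smul₀ (laplace_pos hμ u).ne' _

/-- Strict convexity of `log ∘ laplace μ`, in exponentiated form: the graph of the log-Laplace
transform lies strictly above its tangent planes. It is `exp t > 1 + t` integrated against the
tilted measure. -/
theorem laplace_mul_exp_lt (hμ : ∀ A : ℝ, Integrable (fun y => Real.exp (A * ‖y‖)) μ)
    [μ.IsOpenPosMeasure] {u v : E} (huv : v ≠ u) :
    laplace μ u * Real.exp ⟪v - u, tiltedMean μ u⟫ < laplace μ v := by
  set m := ⟪v - u, tiltedMean μ u⟫ with hm
  have hN : ⟪v - u, tiltedMoment μ u⟫ = m * laplace μ u := by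
    rw [← laplace_smul_tiltedMean hμ, inner_smul_right, mul_comm]
  have i1 := integrable_exp_inner hμ u
  have i2 := integrable_exp_inner_mul_inner hμ u (v - u)
  have i3 := integrable_exp_inner hμ v
  have i4 : Integrable (fun y => (1 - m) * Real.exp ⟪u, y⟫ + Real.exp ⟪u, y⟫ * ⟪v - u, y⟫) μ :=
    (i1.const_mul _).add i2
  have i5 : Integrable (fun y => Real.exp ⟪v, y⟫ -
      Real.exp m * ((1 - m) * Real.exp ⟪u, y⟫ + Real.exp ⟪u, y⟫ * ⟪v - u, y⟫)) μ :=
    i3.sub (i4.const_mul _)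
  have hfac : ∀ y : E, Real.exp ⟪v, y⟫ -
      Real.exp m * ((1 - m) * Real.exp ⟪u, y⟫ + Real.exp ⟪u, y⟫ * ⟪v - u, y⟫) =
      Real.exp m * Real.exp ⟪u, y⟫ *
        (Real.exp (⟪v - u, y⟫ - m) - (⟪v - u, y⟫ - m + 1)) := fun y => by
    have : Real.exp ⟪v, y⟫ = Real.exp m * Real.exp ⟪u, y⟫ * Real.exp (⟪v - u, y⟫ - m) := by
      rw [← Real.exp_add, ← Real.exp_add, inner_sub_left]
      ring_nf
    rw [this]
    ring
  obtain ⟨y₀, hy₀⟩ := exists_inner_eq (sub_ne_zero.2 huv) (m + 1)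
  have key := integral_pos_of_integrable_nonneg_nonzero (x := y₀) (μ := μ)
    (by fun_prop) i5 (fun y => by
      simp only [Pi.zero_apply]
      rw [hfac]
      exact mul_nonneg (by positivity) (sub_nonneg.2 (Real.add_one_le_exp _)))
    (by
      rw [hfac]
      have := Real.add_one_lt_exp (x := ⟪v - u, y₀⟫ - m) (by rw [hy₀]; simp)
      exact (mul_pos (by positivity) (sub_pos.2 this)).ne')
  have e4 : ∫ y, ((1 - m) * Real.exp ⟪u, y⟫ + Real.exp ⟪u, y⟫ * ⟪v - u, y⟫) ∂μ
      = laplace μ u := by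
    rw [integral_add (i1.const_mul _) i2, integral_const_mul, integral_exp_inner_mul_inner hμ, hN,
      laplace]
    ring
  rw [integral_sub i3 (i4.const_mul _), integral_const_mul, e4] at key
  rw [mul_comm]
  exact sub_pos.1 key

theorem log_laplace_add_inner_lt (hμ : ∀ A : ℝ, Integrable (fun y => Real.exp (A * ‖y‖)) μ)
    [μ.IsOpenPosMeasure] {u v : E} (huv : v ≠ u) :
    Real.log (laplace μ u) + ⟪v - u, tiltedMean μ u⟫ < Real.log (laplace μ v) := by
  have h := Real.log_lt_log (mul_pos (laplace_pos hμ u) (Real.exp_pos _))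
    (laplace_mul_exp_lt hμ huv)
  rwa [Real.log_mul (laplace_pos hμ u).ne' (Real.exp_pos _).ne', Real.log_exp] at h

/-! ### The tilted mean is a diffeomorphism -/

theorem tiltedMean_injective (hμ : ∀ A : ℝ, Integrable (fun y => Real.exp (A * ‖y‖)) μ)
    [μ.IsOpenPosMeasure] : Function.Injective (tiltedMean μ) := by
  intro u v h
  by_contra huv
  have h1 := log_laplace_add_inner_lt hμ huv
  have h2 := log_laplace_add_inner_lt hμ (Ne.symm huv)
  rw [h] at h2
  rw [← neg_sub v u, inner_neg_left] at h1
  linarith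

/-- The positive part of `⟪u, y - p⟫` has a first moment growing linearly in `u`, because no
half-space is `μ`-null. This makes the tilted partition function coercive. -/
theorem exists_mul_norm_le_integral_max (hμ : ∀ A : ℝ, Integrable (fun y => Real.exp (A * ‖y‖)) μ)
    [μ.IsOpenPosMeasure] (p : E) :
    ∃ c : ℝ, 0 < c ∧ ∀ u : E, c * ‖u‖ ≤ ∫ y, max 0 ⟪u, y - p⟫ ∂μ := by
  have hb : ∀ u y : E, ‖max 0 ⟪u, y - p⟫‖ ≤ ‖u‖ * (‖y‖ + ‖p‖) := fun u y => by
    rw [Real.norm_of_nonneg (le_max_left _ _)]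
    refine max_le (by positivity) ((real_inner_le_norm _ _).trans ?_)
    gcongr
    exact norm_sub_le y p
  have i0 : Integrable (fun y : E => ‖y‖ + ‖p‖) μ := by
    have i1 : Integrable (fun y : E => ‖y‖) μ := by
      simpa using (hasExpMoments_id hμ).integrable_exp_mul 0
    have i2 : Integrable (fun _ : E => ‖p‖) μ := by
      simpa using (hμ 0).mul_const ‖p‖
    exact i1.add i2
  have hint : ∀ u : E, Integrable (fun y => max 0 ⟪u, y - p⟫) μ := fun u =>
    (i0.const_mul ‖u‖).mono' (Continuous.aestronglyMeasurable (by fun_prop))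
      (.of_forall (hb u))
  have hcont : ContinuousOn (fun u : E => ∫ y, max 0 ⟪u, y - p⟫ ∂μ) (Metric.sphere 0 1) := by
    refine continuousOn_of_dominated (bound := fun y : E => ‖y‖ + ‖p‖)
      (fun u _ => (hint u).aestronglyMeasurable) (fun u hu => .of_forall fun y => ?_) i0
      (.of_forall fun y => Continuous.continuousOn (by fun_prop))
    simpa [mem_sphere_zero_iff_norm.1 hu] using hb u y
  obtain ⟨c, hc, hcu⟩ := (isCompact_sphere (0 : E) 1).exists_forall_le' hcont (a := 0)
    fun u hu => by
      have hu0 : u ≠ 0 := ne_zero_of_mem_unit_sphere ⟨u, hu⟩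
      obtain ⟨y₀, hy₀⟩ := exists_inner_eq hu0 (⟪u, p⟫ + 1)
      refine integral_pos_of_integrable_nonneg_nonzero (x := y₀) (by fun_prop) (hint u)
        (fun y => le_max_left _ _) ?_
      simp [inner_sub_right, hy₀]
  refine ⟨c, hc, fun u => ?_⟩
  rcases eq_or_ne u 0 with rfl | hu
  · simp
  have hu' := norm_pos_iff.2 hu
  have h := hcu (‖u‖⁻¹ • u) (by simp [norm_smul, hu'.ne'])
  have e : ∀ y : E, max 0 ⟪u, y - p⟫ = ‖u‖ * max 0 ⟪‖u‖⁻¹ • u, y - p⟫ := fun y => by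
    rw [mul_max_of_nonneg _ _ hu'.le, mul_zero, real_inner_smul_left, mul_inv_cancel_left₀ hu'.ne']
  simp_rw [e, integral_const_mul]
  rw [mul_comm]
  gcongr

/-- A point `p` is attained at a minimizer of `u ↦ ∫ exp ⟪u, y - p⟫ ∂μ`. -/
theorem tiltedMean_surjective (hμ : ∀ A : ℝ, Integrable (fun y => Real.exp (A * ‖y‖)) μ)
    [μ.IsOpenPosMeasure] : Function.Surjective (tiltedMean μ) := by
  intro p
  obtain ⟨c, hc, hcu⟩ := exists_mul_norm_le_integral_max hμ p
  set G : E → ℝ := fun u => Real.exp (-⟪u, p⟫) * laplace μ u with hG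
  have hGint : ∀ u, G u = ∫ y, Real.exp ⟪u, y - p⟫ ∂μ := fun u => by
    simp only [hG, laplace]
    rw [← integral_const_mul]
    congr with y
    rw [← Real.exp_add, inner_sub_right]
    ring_nf
  have hle : ∀ u, c * ‖u‖ ≤ G u := fun u => by
    refine (hcu u).trans ?_
    rw [hGint]
    refine integral_mono_of_nonneg (.of_forall fun y => le_max_left _ _) ?_
      (.of_forall fun y => ?_)
    · refine ((integrable_exp_inner hμ u).const_mul (Real.exp (-⟪u, p⟫))).congr
        (.of_forall fun y => ?_)
      simp only
      rw [← Real.exp_add, inner_sub_right]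
      ring_nf
    · exact max_le (Real.exp_pos _).le ((le_add_of_nonneg_right zero_le_one).trans
        (Real.add_one_le_exp _))
  have hcont : Continuous G := by
    have := (contDiff_laplace hμ).continuous
    fun_prop
  have hlim : Filter.Tendsto G (Filter.cocompact E) Filter.atTop :=
    Filter.tendsto_atTop_mono hle ((tendsto_norm_cocompact_atTop).const_mul_atTop hc)
  obtain ⟨u, hu⟩ := hcont.exists_forall_le hlim
  refine ⟨u, ?_⟩
  have hd1 : HasFDerivAt (fun u : E => Real.exp (-⟪u, p⟫))
      (Real.exp (-⟪u, p⟫) • -innerSL ℝ p) u := by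
    have : HasFDerivAt (fun v : E => ⟪v, p⟫) (innerSL ℝ p) u := by
      simpa only [← innerSL_apply_apply ℝ p, real_inner_comm] using
        (innerSL ℝ p).hasFDerivAt (x := u)
    exact this.neg.exp
  have hd := hd1.mul (hasFDerivAt_laplace hμ u)
  have h0 := (IsLocalMin.hasFDerivAt_eq_zero (.of_forall hu) hd)
  have h1 : tiltedMoment μ u = laplace μ u • p := by
    refine ext_inner_right ℝ fun w => ?_
    have := congrArg (fun T : E →L[ℝ] ℝ => T w) h0
    simp only [add_apply, smul_apply, neg_apply, innerSL_apply_apply, smul_eq_mul,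
      zero_apply] at this
    rw [real_inner_smul_left]
    have hpos := Real.exp_pos (-⟪u, p⟫)
    apply mul_left_cancel₀ hpos.ne'
    linarith
  rw [tiltedMean, h1, inv_smul_smul₀ (laplace_pos hμ u).ne']

/-- The derivative of the tilted mean is the covariance of the tilted measure, and a direction in
its kernel would have zero variance. -/
theorem fderiv_tiltedMean_injective (hμ : ∀ A : ℝ, Integrable (fun y => Real.exp (A * ‖y‖)) μ)
    [μ.IsOpenPosMeasure] (u : E) : Function.Injective (fderiv ℝ (tiltedMean μ) u) := by
  refine (injective_iff_map_eq_zero _).2 fun v hv => ?_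
  by_contra hv0
  have hT := ((contDiff_tiltedMean hμ).differentiable (by simp) u).hasFDerivAt
  have hN := (hasExpMoments_id hμ).hasFDerivAt u
  have hprod := (hasFDerivAt_laplace hμ u).smul hT
  have heq : (laplace μ • tiltedMean μ) = tiltedMoment μ := by
    ext1 w
    exact laplace_smul_tiltedMean hμ w
  -- differentiating `laplace • tiltedMean = tiltedMoment` in the direction `v`
  have hun := congrArg (fun T : E →L[ℝ] E => ⟪v, T v⟫) ((heq ▸ hprod).unique hN)
  set m := ⟪v, tiltedMean μ u⟫ with hm
  have hNv : ⟪v, tiltedMoment μ u⟫ = m * laplace μ u := by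
    rw [← laplace_smul_tiltedMean hμ, inner_smul_right, mul_comm]
  have hI := (hasExpMoments_id hμ).smulRight.integrable u
  have hIv := hI.apply_continuousLinearMap v
  have hsq : ∀ y : E, ⟪v, (Real.exp ⟪u, y⟫ • (innerSL ℝ y).smulRight y) v⟫
      = Real.exp ⟪u, y⟫ * ⟪v, y⟫ ^ 2 := fun y => by
    simp [inner_smul_right, real_inner_comm v y]
    ring
  have i3 : Integrable (fun y => Real.exp ⟪u, y⟫ * ⟪v, y⟫ ^ 2) μ := by
    simpa only [hsq] using hIv.const_inner (𝕜 := ℝ) v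
  simp only [ContinuousLinearMap.integral_apply hI] at hun
  rw [← integral_inner hIv] at hun
  simp only [hsq] at hun
  simp only [add_apply, smul_apply, hv, smul_zero, zero_add, ContinuousLinearMap.smulRight_apply,
    innerSL_apply_apply, inner_smul_right, real_inner_comm v, hNv, ← hm] at hun
  have i1 := integrable_exp_inner hμ u
  have i2 := integrable_exp_inner_mul_inner hμ u v
  obtain ⟨y₀, hy₀⟩ := exists_inner_eq hv0 (m + 1)
  have i4 : Integrable (fun y => 2 * m * (Real.exp ⟪u, y⟫ * ⟪v, y⟫) -
      m ^ 2 * Real.exp ⟪u, y⟫) μ := (i2.const_mul _).sub (i1.const_mul _)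
  have i5 : Integrable (fun y => Real.exp ⟪u, y⟫ * ⟪v, y⟫ ^ 2 -
      (2 * m * (Real.exp ⟪u, y⟫ * ⟪v, y⟫) - m ^ 2 * Real.exp ⟪u, y⟫)) μ :=
    i3.sub i4
  have hfac : ∀ y : E, Real.exp ⟪u, y⟫ * ⟪v, y⟫ ^ 2 -
      (2 * m * (Real.exp ⟪u, y⟫ * ⟪v, y⟫) - m ^ 2 * Real.exp ⟪u, y⟫) =
      Real.exp ⟪u, y⟫ * (⟪v, y⟫ - m) ^ 2 := fun y => by ring
  have key := integral_pos_of_integrable_nonneg_nonzero (x := y₀) (μ := μ) (by fun_prop) i5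
    (fun y => by simp only [Pi.zero_apply]; rw [hfac]; positivity)
    (by rw [hfac, hy₀]; simp)
  rw [integral_sub i3 i4,
    integral_sub (i2.const_mul _) (i1.const_mul _), integral_const_mul, integral_const_mul,
    integral_exp_inner_mul_inner hμ, hNv, ← hun, ← laplace] at key
  nlinarith

end Laplace

/-! ### The Gaussian proposal as a density -/

noncomputable section Proposal

open scoped RealInnerProductSpace

variable {d : ℕ}

theorem integrable_exp_neg_mul_norm_sq {b : ℝ} (hb : 0 < b) :
    Integrable (fun y : EuclideanSpace ℝ (Fin d) => Real.exp (-b * ‖y‖ ^ 2)) := by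
  have h := (GaussianFourier.integrable_cexp_neg_mul_sq_norm_add
    (V := EuclideanSpace ℝ (Fin d)) (b := (b : ℂ)) (by simpa using hb) 0 0).norm
  refine h.congr (.of_forall fun y => ?_)
  simp [Complex.norm_exp, ← Complex.ofReal_pow]

/-- The mass of `exp (-‖y‖² / (2 τ))` under Lebesgue measure. -/
def gaussianMass (d : ℕ) (τ : ℝ) : ℝ :=
  ∫ y : EuclideanSpace ℝ (Fin d), Real.exp (-(2 * τ)⁻¹ * ‖y‖ ^ 2)

theorem gaussianMass_pos {τ : ℝ} (hτ : 0 < τ) : 0 < gaussianMass d τ :=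
  integral_pos_of_integrable_nonneg_nonzero (x := 0) (by fun_prop)
    (integrable_exp_neg_mul_norm_sq (by positivity)) (fun _ => (Real.exp_pos _).le)
    (Real.exp_pos _).ne'

/-- The density of the Gaussian `𝒩(x, τ I)` with respect to Lebesgue measure. -/
def gaussianDensity (τ : ℝ) (x y : EuclideanSpace ℝ (Fin d)) : ℝ :=
  (gaussianMass d τ)⁻¹ * Real.exp (-(2 * τ)⁻¹ * ‖y - x‖ ^ 2)

theorem gaussianDensity_nonneg {τ : ℝ} (hτ : 0 < τ) (x y : EuclideanSpace ℝ (Fin d)) :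
    0 ≤ gaussianDensity τ x y :=
  mul_nonneg (inv_nonneg.2 (gaussianMass_pos hτ).le) (Real.exp_pos _).le

theorem continuous_gaussianDensity (τ : ℝ) (x : EuclideanSpace ℝ (Fin d)) :
    Continuous (gaussianDensity τ x) := by
  unfold gaussianDensity
  fun_prop

theorem integrable_gaussianDensity {τ : ℝ} (hτ : 0 < τ) (x : EuclideanSpace ℝ (Fin d)) :
    Integrable (gaussianDensity τ x) :=
  ((integrable_exp_neg_mul_norm_sq (by positivity)).comp_sub_right x).const_mul _

theorem charFun_withDensity_gaussianDensity {τ : ℝ} (hτ : 0 < τ)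
    (x t : EuclideanSpace ℝ (Fin d)) :
    charFun (volume.withDensity fun y => ENNReal.ofReal (gaussianDensity τ x y)) t =
      Complex.exp (⟪t, x⟫ * Complex.I - τ * ‖t‖ ^ 2 / 2) := by
  have hb : 0 < (((2 * τ)⁻¹ : ℝ) : ℂ).re := by rw [Complex.ofReal_re]; positivity
  have hτc : (τ : ℂ) ≠ 0 := Complex.ofReal_ne_zero.2 hτ.ne'
  have hmass : ((gaussianMass d τ : ℝ) : ℂ) =
      ∫ v : EuclideanSpace ℝ (Fin d), Complex.exp (-(((2 * τ)⁻¹ : ℝ) : ℂ) * ‖v‖ ^ 2) := by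
    rw [gaussianMass, ← integral_complex_ofReal]
    congr with v
    push_cast
    rfl
  have hmass0 : ((gaussianMass d τ : ℝ) : ℂ) ≠ 0 :=
    Complex.ofReal_ne_zero.2 (gaussianMass_pos hτ).ne'
  rw [charFun_apply, integral_withDensity_eq_integral_toReal_smul
    (continuous_gaussianDensity τ x).measurable.ennreal_ofReal (by simp),
    ← integral_add_right_eq_self _ x]
  have e : ∀ v : EuclideanSpace ℝ (Fin d),
      (ENNReal.ofReal (gaussianDensity τ x (v + x))).toReal •
        Complex.exp (⟪v + x, t⟫ * Complex.I) =
      ((gaussianMass d τ : ℝ) : ℂ)⁻¹ * Complex.exp (⟪t, x⟫ * Complex.I) *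
        Complex.exp (-(((2 * τ)⁻¹ : ℝ) : ℂ) * ‖v‖ ^ 2 + Complex.I * ⟪t, v⟫) := fun v => by
    rw [ENNReal.toReal_ofReal (gaussianDensity_nonneg hτ _ _), gaussianDensity,
      add_sub_cancel_right, Complex.real_smul, mul_assoc, ← Complex.exp_add, Complex.ofReal_mul,
      Complex.ofReal_exp, mul_assoc, ← Complex.exp_add, inner_add_left, real_inner_comm t v,
      real_inner_comm t x]
    push_cast
    ring_nf
  simp_rw [e]
  rw [integral_const_mul, GaussianFourier.integral_cexp_neg_mul_sq_norm_add hb,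
    ← GaussianFourier.integral_cexp_neg_mul_sq_norm hb, ← hmass, mul_right_comm,
    mul_left_comm, mul_comm, ← mul_assoc]
  rw [show Complex.I ^ 2 * (‖t‖ : ℂ) ^ 2 / (4 * (((2 * τ)⁻¹ : ℝ) : ℂ)) = -(τ * ‖t‖ ^ 2 / 2) by
    rw [Complex.I_sq]; push_cast; field_simp; ring]
  rw [sub_eq_add_neg, Complex.exp_add]
  field_simp

/-- The proposal is defined as a push-forward; its density is identified by comparing
characteristic functions. -/
theorem proposal_eq_withDensity {lam δ : ℝ} (h : 0 < lam * δ) (x : EuclideanSpace ℝ (Fin d)) :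
    proposal lam δ x =
      volume.withDensity fun y => ENNReal.ofReal (gaussianDensity (lam * δ) x y) := by
  have hS : ((lam * δ) • (1 : Matrix (Fin d) (Fin d) ℝ)).PosSemidef :=
    Matrix.PosSemidef.one.smul h.le
  have := isFiniteMeasure_withDensity_ofReal (integrable_gaussianDensity h x).2
  have : IsFiniteMeasure (proposal lam δ x) := by unfold proposal; infer_instance
  refine Measure.ext_of_charFun ?_
  ext t
  rw [charFun_withDensity_gaussianDensity h, proposal, charFun_multivariateGaussian hS]
  congr 3
  rw [Matrix.smul_mulVec, Matrix.one_mulVec, dotProduct_smul, smul_eq_mul, dotProduct,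
    ← Complex.ofReal_pow, EuclideanSpace.real_norm_sq_eq]
  simp [pow_two]

variable {F : Type*} [NormedAddCommGroup F] [NormedSpace ℝ F]

theorem integral_proposal {lam δ : ℝ} (h : 0 < lam * δ) (x : EuclideanSpace ℝ (Fin d))
    (g : EuclideanSpace ℝ (Fin d) → F) :
    ∫ y, g y ∂(proposal lam δ x) = ∫ y, gaussianDensity (lam * δ) x y • g y := by
  rw [proposal_eq_withDensity h, integral_withDensity_eq_integral_toReal_smul
    (continuous_gaussianDensity _ x).measurable.ennreal_ofReal (by simp)]
  simp_rw [ENNReal.toReal_ofReal (gaussianDensity_nonneg h _ _)]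

theorem integrable_proposal_iff {lam δ : ℝ} (h : 0 < lam * δ) (x : EuclideanSpace ℝ (Fin d))
    (g : EuclideanSpace ℝ (Fin d) → F) :
    Integrable g (proposal lam δ x) ↔
      Integrable (fun y => gaussianDensity (lam * δ) x y • g y) := by
  rw [proposal_eq_withDensity h, integrable_withDensity_iff_integrable_smul'
    (continuous_gaussianDensity _ x).measurable.ennreal_ofReal (by simp)]
  simp_rw [ENNReal.toReal_ofReal (gaussianDensity_nonneg h _ _)]

/-! ### Reduction of the expectations to a Laplace transform -/

/-- The Gibbs weight `exp (-f(y)/δ)` times the centred Gaussian factor `exp (-‖y‖² / (2 lam δ))`.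
Completing the square turns every expectation under `𝒩(x, lam δ I)` of a function weighted by
`exp (-f/δ)` into an exponential tilt of the measure with this density. -/
def gibbsWeight (lam δ : ℝ) (f : EuclideanSpace ℝ (Fin d) → ℝ)
    (y : EuclideanSpace ℝ (Fin d)) : ℝ :=
  Real.exp (-(2 * (lam * δ))⁻¹ * ‖y‖ ^ 2 + -f y / δ)

/-- The measure with density `gibbsWeight lam δ f`. -/
def gibbsMeasure (lam δ : ℝ) (f : EuclideanSpace ℝ (Fin d) → ℝ) :
    Measure (EuclideanSpace ℝ (Fin d)) :=
  volume.withDensity fun y => ENNReal.ofReal (gibbsWeight lam δ f y)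

variable {lam δ : ℝ} {f : EuclideanSpace ℝ (Fin d) → ℝ}

theorem continuous_gibbsWeight (hf : Continuous f) : Continuous (gibbsWeight lam δ f) := by
  unfold gibbsWeight
  fun_prop

theorem gibbsWeight_pos (y : EuclideanSpace ℝ (Fin d)) : 0 < gibbsWeight lam δ f y :=
  Real.exp_pos _

theorem integral_gibbsMeasure (hf : Continuous f) (g : EuclideanSpace ℝ (Fin d) → F) :
    ∫ y, g y ∂(gibbsMeasure lam δ f) = ∫ y, gibbsWeight lam δ f y • g y := by
  rw [gibbsMeasure, integral_withDensity_eq_integral_toReal_smul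
    (continuous_gibbsWeight hf).measurable.ennreal_ofReal (by simp)]
  simp_rw [ENNReal.toReal_ofReal (gibbsWeight_pos _).le]

theorem integrable_gibbsMeasure_iff (hf : Continuous f) (g : EuclideanSpace ℝ (Fin d) → F) :
    Integrable g (gibbsMeasure lam δ f) ↔ Integrable (fun y => gibbsWeight lam δ f y • g y) := by
  rw [gibbsMeasure, integrable_withDensity_iff_integrable_smul'
    (continuous_gibbsWeight hf).measurable.ennreal_ofReal (by simp)]
  simp_rw [ENNReal.toReal_ofReal (gibbsWeight_pos _).le]

theorem isOpenPosMeasure_gibbsMeasure (hf : Continuous f) :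
    (gibbsMeasure lam δ f).IsOpenPosMeasure :=
  (withDensity_absolutelyContinuous'
    (continuous_gibbsWeight hf).measurable.ennreal_ofReal.aemeasurable
    (.of_forall fun y => by simpa using gibbsWeight_pos y)).isOpenPosMeasure

/-- The Gaussian factor dominates `exp (A * ‖y‖)`, leaving the integrable weight `exp (-f/δ)`. -/
theorem integrable_exp_norm_gibbsMeasure (h : 0 < lam * δ) (hf : StandingAssumption δ f) (A : ℝ) :
    Integrable (fun y => Real.exp (A * ‖y‖)) (gibbsMeasure lam δ f) := by
  rw [integrable_gibbsMeasure_iff hf.continuous]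
  refine (hf.integrable.const_mul (Real.exp (lam * δ * A ^ 2 / 2))).mono'
    (Continuous.aestronglyMeasurable ?_) (.of_forall fun y => ?_)
  · have := continuous_gibbsWeight (lam := lam) (δ := δ) hf.continuous
    fun_prop
  · rw [smul_eq_mul, gibbsWeight, ← Real.exp_add, ← Real.exp_add, Real.norm_eq_abs, Real.abs_exp,
      Real.exp_le_exp]
    -- completing the square in `‖y‖`
    have : 0 ≤ (2 * (lam * δ))⁻¹ * (‖y‖ - lam * δ * A) ^ 2 := by positivity
    have e : (2 * (lam * δ))⁻¹ * (‖y‖ - lam * δ * A) ^ 2 =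
        (2 * (lam * δ))⁻¹ * ‖y‖ ^ 2 - A * ‖y‖ + lam * δ * A ^ 2 / 2 := by
      have := h.ne'
      set τ := lam * δ
      field_simp
      ring
    linarith

/-- The density of `𝒩(0, τ I)` at `x`. With `τ = lam δ` it is the factor that relates expectations
under the proposal at `x` to integrals against the exponentially tilted Gibbs measure. -/
def tiltFactor (τ : ℝ) (x : EuclideanSpace ℝ (Fin d)) : ℝ :=
  (gaussianMass d τ)⁻¹ * Real.exp (-(2 * τ)⁻¹ * ‖x‖ ^ 2)

theorem tiltFactor_pos {τ : ℝ} (hτ : 0 < τ) (x : EuclideanSpace ℝ (Fin d)) :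
    0 < tiltFactor τ x :=
  mul_pos (inv_pos.2 (gaussianMass_pos hτ)) (Real.exp_pos _)

theorem gaussianDensity_mul_exp (x y : EuclideanSpace ℝ (Fin d)) :
    gaussianDensity (lam * δ) x y * Real.exp (-f y / δ) =
      tiltFactor (lam * δ) x * (gibbsWeight lam δ f y * Real.exp ⟪(lam * δ)⁻¹ • x, y⟫) := by
  rw [gaussianDensity, tiltFactor, gibbsWeight, mul_assoc, mul_assoc, ← Real.exp_add,
    ← Real.exp_add, ← Real.exp_add, norm_sub_sq_real, real_inner_smul_left, real_inner_comm x y]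
  congr 2
  field_simp
  ring

theorem integrable_exp_smul_proposal (h : 0 < lam * δ) (hf : Continuous f)
    {g : EuclideanSpace ℝ (Fin d) → F} {x : EuclideanSpace ℝ (Fin d)}
    (hg : Integrable (fun y => Real.exp ⟪(lam * δ)⁻¹ • x, y⟫ • g y) (gibbsMeasure lam δ f)) :
    Integrable (fun y => Real.exp (-f y / δ) • g y) (proposal lam δ x) := by
  rw [integrable_gibbsMeasure_iff hf] at hg
  rw [integrable_proposal_iff h]
  refine (hg.smul (tiltFactor (lam * δ) x)).congr (.of_forall fun y => ?_)
  simp only [Pi.smul_apply, smul_smul]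
  rw [gaussianDensity_mul_exp]

theorem integral_exp_smul_proposal (h : 0 < lam * δ) (hf : Continuous f)
    (g : EuclideanSpace ℝ (Fin d) → F) (x : EuclideanSpace ℝ (Fin d)) :
    ∫ y, Real.exp (-f y / δ) • g y ∂(proposal lam δ x) =
      tiltFactor (lam * δ) x •
        ∫ y, Real.exp ⟪(lam * δ)⁻¹ • x, y⟫ • g y ∂(gibbsMeasure lam δ f) := by
  rw [integral_gibbsMeasure hf, integral_proposal h, ← integral_smul]
  congr with y
  simp only [smul_smul]
  rw [gaussianDensity_mul_exp]

theorem integral_exp_proposal (h : 0 < lam * δ) (hf : Continuous f)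
    (x : EuclideanSpace ℝ (Fin d)) :
    ∫ y, Real.exp (-f y / δ) ∂(proposal lam δ x) =
      tiltFactor (lam * δ) x * laplace (gibbsMeasure lam δ f) ((lam * δ)⁻¹ • x) := by
  simpa [laplace] using integral_exp_smul_proposal h hf (fun _ => (1 : ℝ)) x

theorem zprox_eq_tiltedMean (h : 0 < lam * δ) (hf : Continuous f)
    (x : EuclideanSpace ℝ (Fin d)) :
    zprox lam δ f x = tiltedMean (gibbsMeasure lam δ f) ((lam * δ)⁻¹ • x) := by
  have h0 := (tiltFactor_pos h x).ne'
  rw [zprox, integral_exp_proposal h hf, integral_exp_smul_proposal h hf, tiltedMean,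
    tiltedMoment, smul_smul, mul_inv, mul_right_comm, inv_mul_cancel₀ h0, one_mul]

/-! ### The proximal representation -/

theorem zprox_bijective (h : 0 < lam * δ) (hf : StandingAssumption δ f) :
    Function.Bijective (zprox lam δ f) := by
  have hμ := integrable_exp_norm_gibbsMeasure h hf
  have := isOpenPosMeasure_gibbsMeasure (lam := lam) (δ := δ) hf.continuous
  rw [show zprox lam δ f = tiltedMean (gibbsMeasure lam δ f) ∘ fun x => (lam * δ)⁻¹ • x from
    funext (zprox_eq_tiltedMean h hf.continuous)]
  exact Function.Bijective.comp ⟨tiltedMean_injective hμ, tiltedMean_surjective hμ⟩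
    (MulAction.bijective₀ (inv_ne_zero h.ne'))

theorem contDiff_zprox (h : 0 < lam * δ) (hf : StandingAssumption δ f) :
    ContDiff ℝ ∞ (zprox lam δ f) := by
  have := isOpenPosMeasure_gibbsMeasure (lam := lam) (δ := δ) hf.continuous
  rw [show zprox lam δ f = tiltedMean (gibbsMeasure lam δ f) ∘ fun x => (lam * δ)⁻¹ • x from
    funext (zprox_eq_tiltedMean h hf.continuous)]
  exact (contDiff_tiltedMean (integrable_exp_norm_gibbsMeasure h hf)).comp
    (contDiff_const_smul _)

theorem zprox_zproxInv (h : 0 < lam * δ) (hf : StandingAssumption δ f)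
    (y : EuclideanSpace ℝ (Fin d)) : zprox lam δ f (zproxInv lam δ f y) = y :=
  Function.rightInverse_invFun (zprox_bijective h hf).2 y

theorem zproxInv_zprox (h : 0 < lam * δ) (hf : StandingAssumption δ f)
    (x : EuclideanSpace ℝ (Fin d)) : zproxInv lam δ f (zprox lam δ f x) = x :=
  Function.leftInverse_invFun (zprox_bijective h hf).1 x

theorem contDiff_zproxInv (h : 0 < lam * δ) (hf : StandingAssumption δ f) :
    ContDiff ℝ ∞ (zproxInv lam δ f) := by
  have hμ := integrable_exp_norm_gibbsMeasure h hf
  have := isOpenPosMeasure_gibbsMeasure (lam := lam) (δ := δ) hf.continuous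
  have hg : ContDiff ℝ ∞ (fun y => (lam * δ)⁻¹ • zproxInv lam δ f y) :=
    (contDiff_tiltedMean hμ).of_rightInverse (tiltedMean_injective hμ)
      (fderiv_tiltedMean_injective hμ) fun y => by
        rw [← zprox_eq_tiltedMean h hf.continuous, zprox_zproxInv h hf]
  have h1 := hg.const_smul (lam * δ)
  simp only [smul_inv_smul₀ h.ne'] at h1
  exact h1

/-- Once the definitions are unfolded at `y = zprox u`, the quadratic terms in `u` and `y` cancel,
and the prox objective becomes a tangent plane of the log-Laplace transform at `u`, evaluated at
`x` and negated, up to a term depending on `x` only. -/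
theorem proxPotential_zprox_add (hδ : 0 < δ) (h : 0 < lam * δ) (hf : StandingAssumption δ f)
    (x u : EuclideanSpace ℝ (Fin d)) :
    proxPotential lam δ f (zprox lam δ f u) +
        1 / (2 * (lam * δ)) * ‖x - zprox lam δ f u‖ ^ 2 =
      Real.log (gaussianMass d (lam * δ)) + (2 * (lam * δ))⁻¹ * ‖x‖ ^ 2 -
        (Real.log (laplace (gibbsMeasure lam δ f) ((lam * δ)⁻¹ • u)) +
          ⟪(lam * δ)⁻¹ • x - (lam * δ)⁻¹ • u,
            tiltedMean (gibbsMeasure lam δ f) ((lam * δ)⁻¹ • u)⟫) := by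
  have := isOpenPosMeasure_gibbsMeasure (lam := lam) (δ := δ) hf.continuous
  have hL := laplace_pos (integrable_exp_norm_gibbsMeasure h hf) ((lam * δ)⁻¹ • u)
  rw [proxPotential, softMoreauEnvelope, zproxInv_zprox h hf, integral_exp_proposal h hf.continuous,
    Real.log_mul (tiltFactor_pos h u).ne' hL.ne', tiltFactor,
    Real.log_mul (inv_ne_zero (gaussianMass_pos h).ne') (Real.exp_pos _).ne', Real.log_exp,
    Real.log_inv, ← zprox_eq_tiltedMean h hf.continuous, norm_sub_sq_real, norm_sub_sq_real,
    inner_sub_left, real_inner_smul_left, real_inner_smul_left, mul_assoc 2 lam δ]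
  set τ := lam * δ
  field_simp
  ring

/-- Every point is `zprox u` for a unique `u`; by strict convexity of the log-Laplace transform the
tangent plane at `u` is highest at `x` exactly when `u = x`. -/
theorem isProxOf_zprox (hδ : 0 < δ) (h : 0 < lam * δ) (hf : StandingAssumption δ f) :
    IsProxOf (zprox lam δ f) (lam * δ) (proxPotential lam δ f) := by
  have hμ := integrable_exp_norm_gibbsMeasure h hf
  have := isOpenPosMeasure_gibbsMeasure (lam := lam) (δ := δ) hf.continuous
  intro x
  have hlt : ∀ u, u ≠ x →
      proxPotential lam δ f (zprox lam δ f x) +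
        1 / (2 * (lam * δ)) * ‖x - zprox lam δ f x‖ ^ 2 <
      proxPotential lam δ f (zprox lam δ f u) +
        1 / (2 * (lam * δ)) * ‖x - zprox lam δ f u‖ ^ 2 := fun u hu => by
    have hne : (lam * δ)⁻¹ • x ≠ (lam * δ)⁻¹ • u :=
      (smul_right_injective _ (inv_ne_zero h.ne')).ne hu.symm
    rw [proxPotential_zprox_add hδ h hf, proxPotential_zprox_add hδ h hf, sub_self,
      inner_zero_left]
    linarith [log_laplace_add_inner_lt hμ hne]
  ext y
  obtain ⟨u, rfl⟩ := (zprox_bijective h hf).2 y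
  rw [Set.mem_singleton_iff, (zprox_bijective h hf).1.eq_iff]
  constructor
  · intro hmin
    by_contra hu
    exact (hlt u hu).not_ge (hmin _)
  · rintro rfl z
    obtain ⟨v, rfl⟩ := (zprox_bijective h hf).2 z
    rcases eq_or_ne v u with rfl | hv
    · exact le_rfl
    · exact (hlt v hv).le

end Proposal

theorem theorem1 {d : ℕ} (lam δ : ℝ) (hlam : 0 < lam) (hδ : 0 < δ)
    (f : EuclideanSpace ℝ (Fin d) → ℝ) (hf : StandingAssumption δ f) :
    -- the expectations exist and the normalization is positive, so all objects are well defined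
    (∀ x, Integrable (fun y => Real.exp (-f y / δ)) (proposal lam δ x) ∧
      Integrable (fun y => Real.exp (-f y / δ) • y) (proposal lam δ x) ∧
      0 < ∫ y, Real.exp (-f y / δ) ∂(proposal lam δ x)) ∧
    -- `zprox` is a smooth bijection with smooth inverse
    ContDiff ℝ ∞ (zprox lam δ f) ∧
    Function.Bijective (zprox lam δ f) ∧
    ContDiff ℝ ∞ (zproxInv lam δ f) ∧
    -- `zprox` is the proximal operator of `lam δ H`
    IsProxOf (zprox lam δ f) (lam * δ) (proxPotential lam δ f) ∧
    -- every sequence generated by ZOPPA is a proximal point iteration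
    (∀ x : ℕ → EuclideanSpace ℝ (Fin d), IsZOPPASequence lam δ f x →
      IsProximalPointIteration (lam * δ) (proxPotential lam δ f) x) := by
  have h : 0 < lam * δ := mul_pos hlam hδ
  have hμ := integrable_exp_norm_gibbsMeasure h hf
  have := isOpenPosMeasure_gibbsMeasure (lam := lam) (δ := δ) hf.continuous
  refine ⟨fun x => ⟨?_, ?_, ?_⟩, contDiff_zprox h hf, zprox_bijective h hf,
    contDiff_zproxInv h hf, isProxOf_zprox hδ h hf, fun x hx k => ?_⟩
  · simpa using integrable_exp_smul_proposal h hf.continuous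
      ((hasExpMoments_one hμ).integrable ((lam * δ)⁻¹ • x))
  · exact integrable_exp_smul_proposal h hf.continuous ((hasExpMoments_id hμ).integrable _)
  · rw [integral_exp_proposal h hf.continuous]
    exact mul_pos (tiltFactor_pos h x) (laplace_pos hμ _)
  · rw [hx k]
    exact isProxOf_zprox hδ h hf (x k)
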